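/- Let $m>n\ge 2$ be integers. Let $\mathcal P^m_{m,n}$ be the set of real positive semidefinite $m\times m$ matrices of rank exactly $n$ all of whose diagonal entries are equal. Give it the Zariski topology: a subset is open if it is the complement in $\mathcal P^m_{m,n}$ of the common zero set of some real polynomials in the matrix entries. A symmetric matrix $B=(B_{ij})$ is a *symmetric rearrangement* of a symmetric matrix $A=(A_{ij})$ if $B_{ii}=A_{ii}$ for all $i$ and the sets of triples $\{(A_{ii},A_{jj},A_{ij}) : 1\le i,j\le m\}$ and $\{(B_{ii},B_{jj},B_{ij}) : 1\le i,j\le m\}$ are equal. Matrices $A$ and $B$ are *equivalent* if $A=X^\top X$ and $B=Y^\top Y$ for some real $n\times m$ matrix $X$ and some matrix $Y$ obtained from $X$ by permuting its columns. Then there is a non-empty, Zariski dense, Zariski open subset $U$ of $\mathcal P^m_{m,n}$ such that for every $A\in U$, no symmetric rearrangement of $A$ that is not equivalent to $A$ lies in $\mathcal P^m_{m,n}$. -/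

import Mathlib

namespace GramRearrangement

/-- `𝒫^ℓ_{m,n}`: the real positive semidefinite `m × m` matrices of rank exactly `n` having at
least `ℓ` equal diagonal entries. For `ℓ = m` the whole diagonal is constant. -/
def P (ℓ m n : ℕ) : Set (Matrix (Fin m) (Fin m) ℝ) :=
  {A | A.PosSemidef ∧ A.rank = n ∧
    ∃ (s : Finset (Fin m)) (c : ℝ), ℓ ≤ s.card ∧ ∀ i ∈ s, A i i = c}

/-- The set of triples `𝒯(A) = {(A_ii, A_jj, A_ij)}`. -/
def triples {m : ℕ} (A : Matrix (Fin m) (Fin m) ℝ) : Set (ℝ × ℝ × ℝ) :=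
  {t | ∃ i j : Fin m, t = (A i i, A j j, A i j)}

/-- `B` is a symmetric rearrangement of `A`: both are symmetric, they have the same diagonal, and
they have the same set of triples. -/
def IsSymmRearrangement {m : ℕ} (A B : Matrix (Fin m) (Fin m) ℝ) : Prop :=
  A.IsSymm ∧ B.IsSymm ∧ (∀ i, B i i = A i i) ∧ triples B = triples A

/-- `B` is equivalent to the Gram matrix `A`: `A = Xᵀ X` and `B = Yᵀ Y`, where `X` is an `n × m`
matrix and `Y` is obtained from `X` by permuting its columns. -/
def IsEquivalent {m : ℕ} (n : ℕ) (A B : Matrix (Fin m) (Fin m) ℝ) : Prop :=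
  ∃ (X : Matrix (Fin n) (Fin m) ℝ) (σ : Equiv.Perm (Fin m)),
    A = X.transpose * X ∧ B = (X.submatrix id σ).transpose * X.submatrix id σ

/-- `U` is Zariski open in `V`, a set of real `m × m` matrices: `U` is the complement in `V` of the
common zeros of a set of real polynomials in the matrix entries. -/
def IsZariskiOpenIn {m : ℕ} (V U : Set (Matrix (Fin m) (Fin m) ℝ)) : Prop :=
  ∃ S : Set (MvPolynomial (Fin m × Fin m) ℝ),
    U = {A | A ∈ V ∧ ¬ ∀ f ∈ S, MvPolynomial.eval (fun p => A p.1 p.2) f = 0}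

/-- `U` is Zariski dense in `V`: it meets every nonempty Zariski open subset of `V`. -/
def IsZariskiDenseIn {m : ℕ} (V U : Set (Matrix (Fin m) (Fin m) ℝ)) : Prop :=
  U ⊆ V ∧ ∀ W, IsZariskiOpenIn V W → W.Nonempty → (W ∩ U).Nonempty

end GramRearrangement

/-! For generic `A` the off-diagonal entries differ from each other and from the diagonal, so a
symmetric rearrangement `B` amounts to a permutation `π` of the edges of the complete graph on the
indices. If `B` has rank `n`, its principal minors of size `n + 1` vanish; these are polynomials in
the entries of `A`, so for generic `A` each must vanish on all of `sphericalGram m n`.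

Testing them on standard basis vectors chosen by an `n`-coloring gives 0-1 determinants; when the
monochromatic pairs form a star with `k` leaves, the value is `1 - k`. Vanishing therefore makes `π`
degenerate, and stars with 0, 2 and 3 leaves already force `π` to come from a vertex permutation
(`IsDegeneratePerm.exists_perm`), whence `B` is equivalent to `A`.

"Generic" makes sense because `sphericalGram m n`, which also allows rank below `n`, is irreducible:
its points are joined by analytic paths (`sphericalGram_irreducible`). -/

namespace GramRearrangement

/-! ### Degenerate edge permutations come from vertex permutations -/

section Combinatorics

variable {V : Type*}

/-- A graph with at most `(n + 1).choose 2` edges and no `(n + 1)`-clique is `n`-colorable. -/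
theorem exists_coloring_of_cliqueFree [Fintype V] [DecidableEq V] (G : SimpleGraph V) [DecidableRel G.Adj] {n : ℕ}
    (hn : 0 < n) (hE : G.edgeFinset.card ≤ (n + 1).choose 2) (hG : G.CliqueFree (n + 1))
    (s : Finset V) :
    ∃ κ : V → Fin n, ∀ i ∈ s, ∀ j ∈ s, G.Adj i j → κ i ≠ κ j := by
  induction s using Finset.strongInduction with
  | H s ih =>
    by_cases h : ∃ v ∈ s, (s.filter (G.Adj v)).card < n
    -- A vertex with fewer than `n` neighbours in `s` can be colored last.
    · obtain ⟨v, hv, hd⟩ := h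
      obtain ⟨κ, hκ⟩ := ih (s.erase v) (Finset.erase_ssubset hv)
      have : ∃ a : Fin n, a ∉ (s.filter (G.Adj v)).image κ := by
        by_contra! hc
        have h1 : (Finset.univ : Finset (Fin n)) ⊆ (s.filter (G.Adj v)).image κ :=
          fun a _ => hc a
        have h2 := (Finset.card_le_card h1).trans Finset.card_image_le
        simp at h2
        omega
      obtain ⟨a, ha⟩ := this
      refine ⟨Function.update κ v a, fun i hi j hj hij => ?_⟩
      have key : ∀ k ∈ s, G.Adj v k → κ k ≠ a := fun k hk hvk hka =>
        ha (Finset.mem_image.2 ⟨k, by simp [hk, hvk], hka⟩)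
      by_cases hiv : i = v
      · subst hiv
        rw [Function.update_self, Function.update_of_ne hij.ne']
        exact (key j hj hij).symm
      · by_cases hjv : j = v
        · subst hjv
          rw [Function.update_self, Function.update_of_ne hiv]
          exact key i hi hij.symm
        · rw [Function.update_of_ne hiv, Function.update_of_ne hjv]
          exact hκ i (by simp [hi, hiv]) j (by simp [hj, hjv]) hij
    · push Not at h
      rcases s.eq_empty_or_nonempty with rfl | ⟨v, hv⟩
      · exact ⟨fun _ => ⟨0, hn⟩, by simp⟩
      exfalso
      have hsub : ∀ v ∈ s, s.filter (G.Adj v) ⊆ s.erase v := fun v _ w hw => by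
        simp only [Finset.mem_filter] at hw
        exact Finset.mem_erase.2 ⟨hw.2.ne', hw.1⟩
      have hge : n + 1 ≤ s.card := by
        have := (h v hv).trans (Finset.card_le_card (hsub v hv))
        rw [Finset.card_erase_of_mem hv] at this
        omega
      -- All degrees inside `s` are now at least `n`. Counting edges bounds `s` by `n + 1` vertices,
      -- so `s` would be a clique.
      have hsum : s.card * n ≤ (n + 1) * n := by
        calc s.card * n = ∑ v ∈ s, n := by simp
          _ ≤ ∑ v ∈ s, G.degree v := Finset.sum_le_sum fun v hv => (h v hv).trans <|
              Finset.card_le_card fun w hw => by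
                simp only [Finset.mem_filter] at hw
                simpa using hw.2
          _ ≤ ∑ v, G.degree v := Finset.sum_le_sum_of_subset (Finset.subset_univ s)
          _ = 2 * G.edgeFinset.card := G.sum_degrees_eq_twice_card_edges
          _ ≤ 2 * (n + 1).choose 2 := by omega
          _ = (n + 1) * n := by
              rw [Nat.choose_two_right, Nat.mul_div_cancel' (by
                simpa [mul_comm] using (Nat.even_mul_succ_self n).two_dvd)]
              simp
      have hcard : s.card = n + 1 := le_antisymm (Nat.le_of_mul_le_mul_right hsum hn) hge
      refine hG s ⟨fun a ha b hb hab => ?_, hcard⟩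
      have heq : s.filter (G.Adj a) = s.erase a := Finset.eq_of_subset_of_card_le (hsub a ha) (by
        rw [Finset.card_erase_of_mem ha]
        have := h a ha
        omega)
      have : b ∈ s.filter (G.Adj a) := by
        rw [heq]
        exact Finset.mem_erase.2 ⟨hab.symm, hb⟩
      exact (Finset.mem_filter.1 this).2

/-- A permutation `π` of the unordered pairs is degenerate in dimension `n` if there is no
`n`-coloring `κ` for which, inside some set `S` of `n + 1` points, the pairs sent by `π` to
monochromatic pairs form a star with a number of leaves different from one. -/
def IsDegeneratePerm [DecidableEq V] (n : ℕ) (π : Equiv.Perm (Sym2 V)) : Prop :=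
  ∀ S : Finset V, S.card = n + 1 → ∀ κ : V → Fin n, ∀ p ∈ S, ∀ L ⊆ S.erase p, L.card ≠ 1 →
    ¬ ∀ i ∈ S, ∀ j ∈ S, i ≠ j →
      (((π s(i, j)).map κ).IsDiag ↔ (i = p ∧ j ∈ L ∨ j = p ∧ i ∈ L))

theorem sym2_eq_of_mem_of_mem {e : Sym2 V} {a b : V} (hab : a ≠ b) (ha : a ∈ e) (hb : b ∈ e) :
    e = s(a, b) := ((Sym2.mem_and_mem_iff hab).1 ⟨ha, hb⟩)

variable [DecidableEq V] {n : ℕ} {π : Equiv.Perm (Sym2 V)}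

/-- Without an `(n + 1)`-clique among the image edges, some `n`-coloring would leave none of them
monochromatic: the star with no leaves. The clique then uses up every image edge, by counting. -/
theorem IsDegeneratePerm.exists_image_clique [Fintype V] (hn : 0 < n) (hπ : ∀ e, (π e).IsDiag ↔ e.IsDiag)
    (h : IsDegeneratePerm n π) {S : Finset V} (hS : S.card = n + 1) :
    ∃ S' : Finset V, S'.card = n + 1 ∧ S.offDiag.image (fun x => π s(x.1, x.2)) =
      S'.offDiag.image (fun x => s(x.1, x.2)) := by
  classical
  have hcard : ∀ T : Finset V, T.card = n + 1 →
      (T.offDiag.image (fun x => s(x.1, x.2))).card = (n + 1).choose 2 := fun T hT => by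
    rw [← hT]
    exact Sym2.card_image_offDiag T
  have hmap : S.offDiag.image (fun x => π s(x.1, x.2)) =
      (S.offDiag.image (fun x => s(x.1, x.2))).image π := by
    rw [Finset.image_image]; rfl
  set E := S.offDiag.image (fun x => π s(x.1, x.2)) with hEdef
  have hE : E.card = (n + 1).choose 2 := by
    rw [hmap, Finset.card_image_of_injective _ π.injective, hcard S hS]
  let G : SimpleGraph V := SimpleGraph.fromEdgeSet (E : Set (Sym2 V))
  have hGE : G.edgeFinset ⊆ E := fun e he => by
    rw [SimpleGraph.mem_edgeFinset, SimpleGraph.edgeSet_fromEdgeSet] at he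
    exact he.1
  by_cases hc : G.CliqueFree (n + 1)
  · exfalso
    obtain ⟨κ, hκ⟩ := exists_coloring_of_cliqueFree G hn
      (hE ▸ Finset.card_le_card (by convert hGE)) hc Finset.univ
    obtain ⟨p, hp⟩ : S.Nonempty := Finset.card_pos.1 (by omega)
    refine h S hS κ p hp ∅ (by simp) (by simp) fun i hi j hj hij => ?_
    have hmem : π s(i, j) ∈ E := Finset.mem_image.2 ⟨(i, j), by simp [hi, hj, hij], rfl⟩
    have hnd : ¬ (π s(i, j)).IsDiag := by rw [hπ]; simpa using hij
    generalize π s(i, j) = e at hmem hnd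
    induction e using Sym2.ind with
    | _ a b =>
      have hab : a ≠ b := by simpa using hnd
      have := hκ a (Finset.mem_univ _) b (Finset.mem_univ _)
        ((SimpleGraph.fromEdgeSet_adj _).2 ⟨hmem, hab⟩)
      simpa using this
  · simp only [SimpleGraph.CliqueFree, not_forall, not_not] at hc
    obtain ⟨S', hS'⟩ := hc
    refine ⟨S', hS'.card_eq, (Finset.eq_of_subset_of_card_le ?_ ?_).symm⟩
    · intro e he
      obtain ⟨⟨a, b⟩, hab, rfl⟩ := Finset.mem_image.1 he
      rw [Finset.mem_offDiag] at hab
      exact ((SimpleGraph.fromEdgeSet_adj _).1 (hS'.isClique hab.1 hab.2.1 hab.2.2)).1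
    · rw [hE, hcard S' hS'.card_eq]

/-- Color classes are the fibres of `r`. On `n + 1` points, identifying any two leaves few enough
classes, so the monochromatic pairs can be prescribed exactly. -/
theorem exists_coloring_of_retraction (S : Finset V) (r : V → V) (hr : (S.image r).card ≤ n)
    (hn : 0 < n) : ∃ κ : V → Fin n, ∀ x ∈ S, ∀ y ∈ S, κ x = κ y ↔ r x = r y := by
  classical
  let f := (S.image r).equivFin
  refine ⟨fun x => if hx : r x ∈ S.image r then Fin.castLE hr (f ⟨r x, hx⟩) else ⟨0, hn⟩,
    fun x hx y hy => ?_⟩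
  have hx' := Finset.mem_image_of_mem r hx
  have hy' := Finset.mem_image_of_mem r hy
  simp only [hx', hy', dif_pos]
  rw [(Fin.castLE_injective hr).eq_iff, f.injective.eq_iff, Subtype.mk.injEq]

/-- If the images were disjoint edges `ab` and `cd`, identifying `a` with `b` and `c` with `d` would
make only these monochromatic; their preimages form a two-leaf star at `i`. -/
theorem IsDegeneratePerm.exists_common_mem [Fintype V] (hn : 2 ≤ n) (hV : n + 1 ≤ Fintype.card V)
    (hπ : ∀ e, (π e).IsDiag ↔ e.IsDiag) (h : IsDegeneratePerm n π) {i j k : V}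
    (hij : i ≠ j) (hik : i ≠ k) (hjk : j ≠ k) :
    ∃ x, x ∈ π s(i, j) ∧ x ∈ π s(i, k) := by
  classical
  by_contra! hdis
  have h3 : ({i, j, k} : Finset V).card = 3 := Finset.card_eq_three.2 ⟨i, j, k, hij, hik, hjk, rfl⟩
  obtain ⟨S, hsub, -, hS⟩ := Finset.exists_subsuperset_card_eq
    (Finset.subset_univ ({i, j, k} : Finset V)) (n := n + 1) (by omega) (by simpa using hV)
  have hi : i ∈ S := hsub (by simp)
  have hj : j ∈ S := hsub (by simp)
  have hk : k ∈ S := hsub (by simp)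
  obtain ⟨S', hS', himg⟩ := h.exists_image_clique (by omega) hπ hS
  have hmem : ∀ x ∈ S, ∀ y ∈ S, x ≠ y → ∃ a b, a ∈ S' ∧ b ∈ S' ∧ a ≠ b ∧ π s(x, y) = s(a, b) := by
    intro x hx y hy hxy
    have : π s(x, y) ∈ S.offDiag.image (fun x => π s(x.1, x.2)) :=
      Finset.mem_image.2 ⟨(x, y), by simp [hx, hy, hxy], rfl⟩
    rw [himg] at this
    obtain ⟨⟨a, b⟩, hab, he⟩ := Finset.mem_image.1 this
    rw [Finset.mem_offDiag] at hab
    exact ⟨a, b, hab.1, hab.2.1, hab.2.2, he.symm⟩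
  obtain ⟨a, b, ha, hb, hab, e1⟩ := hmem i hi j hj hij
  obtain ⟨c, d, hc, hd, hcd, e2⟩ := hmem i hi k hk hik
  rw [e1, e2] at hdis
  have hac : a ≠ c := fun h => hdis a (by simp) (by simp [h])
  have had : a ≠ d := fun h => hdis a (by simp) (by simp [h])
  have hbc : b ≠ c := fun h => hdis b (by simp) (by simp [h])
  have hbd : b ≠ d := fun h => hdis b (by simp) (by simp [h])
  let r : V → V := fun x => if x = b then a else if x = d then c else x
  obtain ⟨κ, hκ⟩ := exists_coloring_of_retraction (n := n) S' r (by
    have : S'.image r ⊆ S'.erase b := fun y hy => by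
      obtain ⟨x, hx, rfl⟩ := Finset.mem_image.1 hy
      simp only [r]
      split_ifs <;> simp_all
      exact fun hc => hbc hc.symm
    have := Finset.card_le_card this
    rw [Finset.card_erase_of_mem hb] at this
    omega) (by omega)
  refine h S hS κ i hi {j, k} ?_ (by rw [Finset.card_pair hjk]; omega) fun x hx y hy hxy => ?_
  · intro z hz
    rcases Finset.mem_insert.1 hz with rfl | hz
    · simp [hj, hij.symm]
    · rw [Finset.mem_singleton] at hz
      subst hz
      simp [hk, hik.symm]
  · obtain ⟨x', y', hx', hy', hxy', e⟩ := hmem x hx y hy hxy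
    have hmono : κ x' = κ y' ↔ s(x', y') = s(a, b) ∨ s(x', y') = s(c, d) := by
      rw [hκ x' hx' y' hy']
      simp only [r, Sym2.eq_iff]
      clear * - hab hcd hac had hbc hbd hxy'
      grind
    rw [e, Sym2.map_mk, Sym2.mk_isDiag_iff]
    rw [hmono, ← e, ← e1, ← e2, π.injective.eq_iff, π.injective.eq_iff]
    simp only [Sym2.eq_iff, Finset.mem_insert, Finset.mem_singleton]
    clear * -
    grind

/-- Suppose a triangle maps to edges `uv`, `uw`, `ux`. The edge `vw` also lies in the image clique,
and its preimage turns out to be some `il`. Identifying `u`, `v`, `w` then gives the three-leaf star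
`ij`, `ik`, `il`. -/
theorem IsDegeneratePerm.not_star [Fintype V] (hn : 2 ≤ n) (hV : n + 1 ≤ Fintype.card V)
    (hπ : ∀ e, (π e).IsDiag ↔ e.IsDiag) (h : IsDegeneratePerm n π) {i j k : V}
    (hij : i ≠ j) (hik : i ≠ k) (hjk : j ≠ k) {u : V} (h1 : u ∈ π s(i, j)) (h2 : u ∈ π s(i, k))
    (h3 : u ∈ π s(j, k)) : False := by
  classical
  have hc3 : ({i, j, k} : Finset V).card = 3 :=
    Finset.card_eq_three.2 ⟨i, j, k, hij, hik, hjk, rfl⟩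
  obtain ⟨S, hsub, -, hS⟩ := Finset.exists_subsuperset_card_eq
    (Finset.subset_univ ({i, j, k} : Finset V)) (n := n + 1) (by omega) (by simpa using hV)
  have hi : i ∈ S := hsub (by simp)
  have hj : j ∈ S := hsub (by simp)
  have hk : k ∈ S := hsub (by simp)
  obtain ⟨S', hS', himg⟩ := h.exists_image_clique (by omega) hπ hS
  have hmem : ∀ x ∈ S, ∀ y ∈ S, x ≠ y → ∃ a b, a ∈ S' ∧ b ∈ S' ∧ a ≠ b ∧ π s(x, y) = s(a, b) := by
    intro x hx y hy hxy
    have : π s(x, y) ∈ S.offDiag.image (fun x => π s(x.1, x.2)) :=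
      Finset.mem_image.2 ⟨(x, y), by simp [hx, hy, hxy], rfl⟩
    rw [himg] at this
    obtain ⟨⟨a, b⟩, hab, he⟩ := Finset.mem_image.1 this
    rw [Finset.mem_offDiag] at hab
    exact ⟨a, b, hab.1, hab.2.1, hab.2.2, he.symm⟩
  have hmemu : ∀ x ∈ S, ∀ y ∈ S, x ≠ y → u ∈ π s(x, y) →
      ∃ b, u ∈ S' ∧ b ∈ S' ∧ u ≠ b ∧ π s(x, y) = s(u, b) := by
    intro x hx y hy hxy hu
    obtain ⟨a, b, ha, hb, hab, e⟩ := hmem x hx y hy hxy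
    rw [e, Sym2.mem_iff] at hu
    rcases hu with rfl | rfl
    · exact ⟨b, ha, hb, hab, e⟩
    · exact ⟨a, hb, ha, hab.symm, by rw [e, Sym2.eq_swap]⟩
  obtain ⟨v, hu, hv, huv, e1⟩ := hmemu i hi j hj hij h1
  obtain ⟨w, -, hw, huw, e2⟩ := hmemu i hi k hk hik h2
  obtain ⟨x, -, hx, hux, e3⟩ := hmemu j hj k hk hjk h3
  have hne : ∀ {e f : Sym2 V}, e ≠ f → π e ≠ π f := fun hef hc => hef (π.injective hc)
  have hvw : v ≠ w := fun hc => by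
    have : π s(i, j) ≠ π s(i, k) := hne (by simp only [ne_eq, Sym2.eq_iff]; grind)
    rw [e1, e2, hc] at this
    exact this rfl
  have hvx : v ≠ x := fun hc => by
    have : π s(i, j) ≠ π s(j, k) := hne (by simp only [ne_eq, Sym2.eq_iff]; grind)
    rw [e1, e3, hc] at this
    exact this rfl
  have hwx : w ≠ x := fun hc => by
    have : π s(i, k) ≠ π s(j, k) := hne (by simp only [ne_eq, Sym2.eq_iff]; grind)
    rw [e2, e3, hc] at this
    exact this rfl
  obtain ⟨p, q, hp, hq, hpq, e4⟩ : ∃ p q, p ∈ S ∧ q ∈ S ∧ p ≠ q ∧ π s(p, q) = s(v, w) := by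
    have : s(v, w) ∈ S'.offDiag.image (fun x => s(x.1, x.2)) :=
      Finset.mem_image.2 ⟨(v, w), by simp [hv, hw, hvw], rfl⟩
    rw [← himg] at this
    obtain ⟨⟨a, b⟩, hab, he⟩ := Finset.mem_image.1 this
    rw [Finset.mem_offDiag] at hab
    exact ⟨a, b, hab.1, hab.2.1, hab.2.2, he⟩
  -- the preimage of `s(v, w)` avoids `j` and `k`
  have havoid : ∀ p q, p ≠ q → π s(p, q) = s(v, w) → p ≠ j ∧ p ≠ k := by
    intro p q hpq e4
    have key : ∀ j k, j ≠ k → π s(j, k) = s(u, x) → p ≠ j := by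
      rintro j k hjk e3 rfl
      by_cases hqk : q = k
      · subst hqk
        rw [e3, Sym2.eq_iff] at e4
        grind
      · obtain ⟨z, hz1, hz2⟩ := h.exists_common_mem hn hV hπ hpq hjk hqk
        rw [e4, Sym2.mem_iff] at hz1
        rw [e3, Sym2.mem_iff] at hz2
        grind
    exact ⟨key j k hjk e3, key k j hjk.symm (by rw [Sym2.eq_swap, e3])⟩
  have hpjk := havoid p q hpq e4
  have hqjk := havoid q p hpq.symm (by rw [Sym2.eq_swap, e4])
  obtain ⟨l, hl, hil, hlj, hlk, e5⟩ :
      ∃ l ∈ S, i ≠ l ∧ l ≠ j ∧ l ≠ k ∧ π s(i, l) = s(v, w) := by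
    by_cases hip : i = p
    · exact ⟨q, hq, hip ▸ hpq, hqjk.1, hqjk.2, hip ▸ e4⟩
    by_cases hiq : i = q
    · exact ⟨p, hp, hip, hpjk.1, hpjk.2, by rw [hiq, Sym2.eq_swap, e4]⟩
    -- Otherwise the image of `ip` meets all three sides of the triangle `uvw`, hence is one of
    -- them, against injectivity of `π`.
    exfalso
    obtain ⟨y, hy1, hy2⟩ := h.exists_common_mem hn hV hπ hip hij hpjk.1
    obtain ⟨z, hz1, hz2⟩ := h.exists_common_mem hn hV hπ hip hik hpjk.2
    obtain ⟨t, ht1, ht2⟩ := h.exists_common_mem hn hV hπ (Ne.symm hip) hpq hiq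
    have n1 : π s(i, p) ≠ π s(i, j) := hne (by simp only [ne_eq, Sym2.eq_iff]; grind)
    have n2 : π s(i, p) ≠ π s(i, k) := hne (by simp only [ne_eq, Sym2.eq_iff]; grind)
    have n3 : π s(i, p) ≠ π s(p, q) := hne (by simp only [ne_eq, Sym2.eq_iff]; grind)
    rw [Sym2.eq_swap] at ht1
    rw [e1] at n1 hy2
    rw [e2] at n2 hz2
    rw [e4] at n3 ht2
    generalize π s(i, p) = e at *
    induction e using Sym2.ind with
    | _ a b =>
      simp only [ne_eq, Sym2.eq_iff, Sym2.mem_iff] at *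
      grind
  let r : V → V := fun y => if y = v then u else if y = w then u else y
  obtain ⟨κ, hκ⟩ := exists_coloring_of_retraction (n := n) S' r (by
    have : S'.image r ⊆ S'.erase v := fun y hy => by
      obtain ⟨z, hz, rfl⟩ := Finset.mem_image.1 hy
      simp only [r]
      split_ifs <;> simp_all
    have := Finset.card_le_card this
    rw [Finset.card_erase_of_mem hv] at this
    omega) (by omega)
  refine h S hS κ i hi {j, k, l} ?_ ?_ fun y hy z hz hyz => ?_
  · intro z hz
    simp only [Finset.mem_insert, Finset.mem_singleton] at hz
    rw [Finset.mem_erase]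
    rcases hz with rfl | rfl | rfl
    · exact ⟨hij.symm, hj⟩
    · exact ⟨hik.symm, hk⟩
    · exact ⟨hil.symm, hl⟩
  · rw [Finset.card_eq_three.2 ⟨j, k, l, hjk, hlj.symm, hlk.symm, rfl⟩]
    omega
  · obtain ⟨y', z', hy', hz', hyz', e⟩ := hmem y hy z hz hyz
    have hmono : κ y' = κ z' ↔
        s(y', z') = s(u, v) ∨ s(y', z') = s(u, w) ∨ s(y', z') = s(v, w) := by
      rw [hκ y' hy' z' hz']
      simp only [r, Sym2.eq_iff]
      clear * - huv huw hvw hyz'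
      grind
    rw [e, Sym2.map_mk, Sym2.mk_isDiag_iff]
    rw [hmono, ← e, ← e1, ← e2, ← e5, π.injective.eq_iff, π.injective.eq_iff, π.injective.eq_iff]
    simp only [Sym2.eq_iff, Finset.mem_insert, Finset.mem_singleton]
    clear * -
    grind

/-- A degenerate permutation of the unordered pairs is induced by a permutation of the points. -/
theorem IsDegeneratePerm.exists_perm [Fintype V] (hn : 2 ≤ n) (hV : n + 1 ≤ Fintype.card V)
    (hπ : ∀ e, (π e).IsDiag ↔ e.IsDiag) (h : IsDegeneratePerm n π) :
    ∃ σ : Equiv.Perm V, ∀ i j, i ≠ j → π s(i, j) = s(σ i, σ j) := by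
  classical
  have hcommon : ∀ i, ∃ a, ∀ j, i ≠ j → a ∈ π s(i, j) := by
    intro i
    obtain ⟨j, hj⟩ : ∃ j, j ∉ ({i} : Finset V) := by
      by_contra! hc
      have := Finset.card_le_card (fun x _ => hc x : Finset.univ ⊆ ({i} : Finset V))
      rw [Finset.card_univ, Finset.card_singleton] at this
      omega
    obtain ⟨k, hk⟩ : ∃ k, k ∉ ({i, j} : Finset V) := by
      by_contra! hc
      have := (Finset.card_le_card (fun x _ => hc x : Finset.univ ⊆ ({i, j} : Finset V))).trans
        Finset.card_le_two
      rw [Finset.card_univ] at this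
      omega
    simp only [Finset.mem_singleton, Finset.mem_insert, not_or] at hj hk
    have hij : i ≠ j := Ne.symm hj
    have hik : i ≠ k := Ne.symm hk.1
    have hjk : j ≠ k := Ne.symm hk.2
    obtain ⟨a, ha1, ha2⟩ := h.exists_common_mem hn hV hπ hij hik hjk
    refine ⟨a, fun l hil => ?_⟩
    by_cases hlj : l = j
    · exact hlj ▸ ha1
    by_cases hlk : l = k
    · exact hlk ▸ ha2
    obtain ⟨y, hy1, hy2⟩ := h.exists_common_mem hn hV hπ hil hij hlj
    obtain ⟨z, hz1, hz2⟩ := h.exists_common_mem hn hV hπ hil hik hlk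
    obtain ⟨s, hs1, hs2⟩ := h.exists_common_mem hn hV hπ hij.symm hjk hik
    obtain ⟨t, ht1, ht2⟩ := h.exists_common_mem hn hV hπ hik.symm hjk.symm hij
    rw [Sym2.eq_swap] at hs1 ht1
    rw [Sym2.eq_swap] at ht2
    have hns : a ∉ π s(j, k) := fun hc => h.not_star hn hV hπ hij hik hjk ha1 ha2 hc
    have n1 : π s(i, l) ≠ π s(j, k) := fun hc => by
      have := π.injective hc
      rw [Sym2.eq_iff] at this
      grind
    have n2 : π s(i, j) ≠ π s(i, k) := fun hc => by
      have := π.injective hc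
      rw [Sym2.eq_iff] at this
      grind
    generalize π s(i, j) = e1 at *
    generalize π s(i, k) = e2 at *
    generalize π s(j, k) = e3 at *
    generalize π s(i, l) = e4 at *
    -- Write the images of `ij` and `ik` as `ya` and `za`. The image of `jk` avoids `a` and meets
    -- both, so it is `yz`; if the image of `il` avoided `a`, it would be `yz` as well.
    by_contra hal
    have hya : y ≠ a := fun hc => hal (hc ▸ hy1)
    have hza : z ≠ a := fun hc => hal (hc ▸ hz1)
    have hsa : s ≠ a := fun hc => hns (hc ▸ hs2)
    have hta : t ≠ a := fun hc => hns (hc ▸ ht2)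
    have f1 := sym2_eq_of_mem_of_mem hya hy2 ha1
    have f2 := sym2_eq_of_mem_of_mem hza hz2 ha2
    have f3 := sym2_eq_of_mem_of_mem hsa hs1 ha1
    have f4 := sym2_eq_of_mem_of_mem hta ht1 ha2
    have hsy : s = y := Sym2.congr_left.1 (f3.symm.trans f1)
    have htz : t = z := Sym2.congr_left.1 (f4.symm.trans f2)
    have hyz : y ≠ z := fun hc => n2 (by rw [f1, f2, hc])
    exact n1 ((sym2_eq_of_mem_of_mem hyz hy1 hz1).trans
      (sym2_eq_of_mem_of_mem hyz (hsy ▸ hs2) (htz ▸ ht2)).symm)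
  choose σ hσ using hcommon
  have hinj : Function.Injective σ := by
    intro i j hij
    by_contra hne
    obtain ⟨k, hk⟩ : ∃ k, k ∉ ({i, j} : Finset V) := by
      by_contra! hc
      have := (Finset.card_le_card (fun x _ => hc x : Finset.univ ⊆ ({i, j} : Finset V))).trans
        Finset.card_le_two
      rw [Finset.card_univ] at this
      omega
    simp only [Finset.mem_singleton, Finset.mem_insert, not_or] at hk
    exact h.not_star hn hV hπ hne (Ne.symm hk.1) (Ne.symm hk.2) (hσ i j hne)
      (hσ i k (Ne.symm hk.1)) (hij ▸ hσ j k (Ne.symm hk.2))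
  refine ⟨Equiv.ofBijective σ (Finite.injective_iff_bijective.1 hinj), fun i j hij => ?_⟩
  have h2 := hσ j i hij.symm
  rw [Sym2.eq_swap] at h2
  exact sym2_eq_of_mem_of_mem (hinj.ne hij) (hσ i j hij) h2

end Combinatorics

end GramRearrangement

/-! ### Irreducibility of spherical Gram matrices -/

namespace GramRearrangement

section SphericalGram

variable {m n : ℕ}

/-- Any two unit vectors lie on an analytically parametrized great circle. -/
theorem exists_great_circle (hn : 2 ≤ n) {u v : EuclideanSpace ℝ (Fin n)} (hu : ‖u‖ = 1)
    (hv : ‖v‖ = 1) : ∃ (w : EuclideanSpace ℝ (Fin n)) (θ : ℝ),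
      (∀ t : ℝ, ‖Real.cos t • u + Real.sin t • w‖ = 1) ∧
      v = Real.cos θ • u + Real.sin θ • w := by
  set a : ℝ := inner ℝ u v with ha
  set z := v - a • u with hz
  have huu : inner ℝ u u = (1 : ℝ) := by rw [real_inner_self_eq_norm_sq, hu]; norm_num
  have huz : inner ℝ u z = (0 : ℝ) := by
    rw [hz, inner_sub_right, inner_smul_right, huu, ← ha]; ring
  obtain ⟨w, hw, huw, hzw⟩ : ∃ w : EuclideanSpace ℝ (Fin n), ‖w‖ = 1 ∧ inner ℝ u w = (0 : ℝ) ∧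
      z = ‖z‖ • w := by
    -- When `v` is parallel to `u`, any unit vector orthogonal to `u` serves; it exists because `n ≥
    -- 2`.
    by_cases h0 : z = 0
    · have hne : (ℝ ∙ u)ᗮ ≠ ⊥ := by
        intro hbot
        have h1 := Submodule.finrank_add_finrank_orthogonal (ℝ ∙ u)
        have h2 := finrank_span_le_card (R := ℝ) ({u} : Set (EuclideanSpace ℝ (Fin n)))
        rw [hbot, finrank_bot, finrank_euclideanSpace_fin] at h1
        simp at h2
        omega
      obtain ⟨y, hy, hy0⟩ := Submodule.exists_mem_ne_zero_of_ne_bot hne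
      rw [Submodule.mem_orthogonal_singleton_iff_inner_right] at hy
      refine ⟨(‖y‖⁻¹ : ℝ) • y, ?_, ?_, by simp [h0]⟩
      · rw [norm_smul, norm_inv, norm_norm, inv_mul_cancel₀ (norm_ne_zero_iff.2 hy0)]
      · rw [inner_smul_right, hy, mul_zero]
    · have h0' := norm_ne_zero_iff.2 h0
      refine ⟨(‖z‖⁻¹ : ℝ) • z, ?_, ?_, ?_⟩
      · rw [norm_smul, norm_inv, norm_norm, inv_mul_cancel₀ h0']
      · rw [inner_smul_right, huz, mul_zero]
      · rw [smul_smul, mul_inv_cancel₀ h0', one_smul]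
  have hnorm : ∀ p q : ℝ, ‖p • u + q • w‖ ^ 2 = p ^ 2 + q ^ 2 := fun p q => by
    rw [norm_add_sq_real, inner_smul_left, inner_smul_right, huw, norm_smul, norm_smul, hu, hw]
    simp
  have hvz : v = a • u + ‖z‖ • w := by rw [← hzw, hz]; abel
  have hsq : a ^ 2 + ‖z‖ ^ 2 = 1 := by rw [← hnorm, ← hvz, hv]; norm_num
  let ζ : ℂ := ⟨a, ‖z‖⟩
  have hζ : ‖ζ‖ = 1 := by
    rw [Complex.norm_eq_sqrt_sq_add_sq, hsq, Real.sqrt_one]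
  refine ⟨w, ζ.arg, fun t => ?_, ?_⟩
  · have := hnorm (Real.cos t) (Real.sin t)
    rw [Real.cos_sq_add_sin_sq] at this
    exact (pow_eq_one_iff_of_nonneg (norm_nonneg _) two_ne_zero).1 this
  · rw [Complex.cos_arg (by rintro h; rw [h] at hζ; simp at hζ), Complex.sin_arg, hζ, div_one,
      div_one]
    exact hvz

/-- The positive multiples of Gram matrices of `m` unit vectors in `n`-space. -/
def sphericalGram (m n : ℕ) : Set (Matrix (Fin m) (Fin m) ℝ) :=
  {A | ∃ (c : ℝ) (x : Fin m → EuclideanSpace ℝ (Fin n)), 0 < c ∧ (∀ i, ‖x i‖ = 1) ∧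
    ∀ i j, A i j = c * inner ℝ (x i) (x j)}

/-- The Zariski topology on the set of spherical Gram matrices is irreducible. -/
theorem sphericalGram_irreducible (hn : 2 ≤ n) {f g : MvPolynomial (Fin m × Fin m) ℝ}
    {A B : Matrix (Fin m) (Fin m) ℝ} (hA : A ∈ sphericalGram m n) (hB : B ∈ sphericalGram m n)
    (hf : MvPolynomial.eval (fun p => A p.1 p.2) f ≠ 0)
    (hg : MvPolynomial.eval (fun p => B p.1 p.2) g ≠ 0) :
    ∃ C ∈ sphericalGram m n, MvPolynomial.eval (fun p => C p.1 p.2) (f * g) ≠ 0 := by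
  obtain ⟨c, x, hc, hx, hA⟩ := hA
  obtain ⟨d, y, hd, hy, hB⟩ := hB
  choose w θ hw hθ using fun i => exists_great_circle hn (hx i) (hy i)
  -- Each vector moves along its great circle and the scale is interpolated geometrically, staying
  -- positive. Along this analytic path from `A` to `B`, a vanishing product of analytic functions
  -- has a vanishing factor.
  let γ : Fin m → ℝ → EuclideanSpace ℝ (Fin n) := fun i t =>
    Real.cos (t * θ i) • x i + Real.sin (t * θ i) • w i
  let r : ℝ → ℝ := fun t => Real.exp ((1 - t) * Real.log c + t * Real.log d)
  let C : ℝ → Fin m × Fin m → ℝ := fun t p => r t * inner ℝ (γ p.1 t) (γ p.2 t)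
  have hC : ∀ p, AnalyticOnNhd ℝ (C · p) Set.univ := by
    intro p t _
    simp only [C, r, γ, PiLp.inner_apply, RCLike.inner_apply, PiLp.add_apply, PiLp.smul_apply,
      conj_trivial]
    fun_prop
  have hCA : C 0 = fun p => A p.1 p.2 := by
    funext p
    simp [C, r, γ, hA, Real.exp_log hc]
  have hCB : C 1 = fun p => B p.1 p.2 := by
    funext p
    simp [C, r, γ, hB, Real.exp_log hd, ← hθ]
  have hfa : AnalyticOnNhd ℝ (fun t => MvPolynomial.eval (C t) f) Set.univ := by
    exact AnalyticOnNhd.aeval_mvPolynomial hC f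
  have hga : AnalyticOnNhd ℝ (fun t => MvPolynomial.eval (C t) g) Set.univ := by
    exact AnalyticOnNhd.aeval_mvPolynomial hC g
  by_contra! hcon
  have := hfa.eq_zero_or_eq_zero_of_mul_eq_zero hga (fun t _ => by
    have := hcon (Matrix.of fun i j => C t (i, j))
      ⟨r t, fun i => γ i t, Real.exp_pos _, fun i => hw i _, fun i j => rfl⟩
    rw [map_mul] at this
    exact this) isPreconnected_univ
  rcases this with h | h
  · exact hf (hCA ▸ h 0 (Set.mem_univ _))
  · exact hg (hCB ▸ h 1 (Set.mem_univ _))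

theorem sphericalGram_prod_ne_zero (hn : 2 ≤ n) {ι : Type*} (s : Finset ι)
    (f : ι → MvPolynomial (Fin m × Fin m) ℝ) (hne : (sphericalGram m n).Nonempty)
    (hf : ∀ i ∈ s, ∃ A ∈ sphericalGram m n, MvPolynomial.eval (fun p => A p.1 p.2) (f i) ≠ 0) :
    ∃ A ∈ sphericalGram m n, MvPolynomial.eval (fun p => A p.1 p.2) (∏ i ∈ s, f i) ≠ 0 := by
  classical
  induction s using Finset.induction_on with
  | empty =>
    obtain ⟨A, hA⟩ := hne
    exact ⟨A, hA, by simp⟩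
  | insert i s hi ih =>
    obtain ⟨A, hA, hfA⟩ := hf i (Finset.mem_insert_self i s)
    obtain ⟨B, hB, hfB⟩ := ih fun j hj => hf j (Finset.mem_insert_of_mem hj)
    rw [Finset.prod_insert hi]
    exact sphericalGram_irreducible hn hA hB hfA hfB

/-- A positive semidefinite matrix of rank `n` is the Gram matrix of vectors in `n`-space. -/
theorem exists_gram_of_posSemidef {A : Matrix (Fin m) (Fin m) ℝ} (hA : A.PosSemidef)
    (hr : A.rank = n) : ∃ x : Fin m → EuclideanSpace ℝ (Fin n),
      ∀ i j, A i j = inner ℝ (x i) (x j) := by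
  obtain ⟨k, v, hv⟩ := Matrix.posSemidef_iff_eq_sum_vecMulVec.1 hA
  let y : Fin m → EuclideanSpace ℝ (Fin k) := fun i => WithLp.toLp 2 fun l => v l i
  have hy : ∀ i j, A i j = inner ℝ (y i) (y j) := fun i j => by
    rw [hv, Matrix.sum_apply, PiLp.inner_apply]
    exact Finset.sum_congr rfl fun l _ => by simp [y, Matrix.vecMulVec_apply, mul_comm]
  let B : Matrix (Fin k) (Fin m) ℝ := Matrix.of fun l i => v l i
  have hAB : A = B.transpose * B := by
    ext i j
    rw [hy, PiLp.inner_apply, Matrix.mul_apply]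
    exact Finset.sum_congr rfl fun l _ => by simp [y, B, mul_comm]
  -- The Gram vectors span a space of dimension `A.rank = n`; orthonormal coordinates on it preserve
  -- inner products.
  let K : Submodule ℝ (EuclideanSpace ℝ (Fin k)) := Submodule.span ℝ (Set.range y)
  have hK : Module.finrank ℝ K = n := by
    rw [← hr, hAB, Matrix.rank_transpose_mul_self, Matrix.rank_eq_finrank_span_cols]
    let e := (WithLp.linearEquiv 2 ℝ (Fin k → ℝ))
    have : Submodule.map (e : EuclideanSpace ℝ (Fin k) →ₗ[ℝ] (Fin k → ℝ)) K =
        Submodule.span ℝ (Set.range B.col) := by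
      rw [Submodule.map_span, ← Set.range_comp]
      rfl
    rw [← this, LinearEquiv.finrank_map_eq]
  let b := (stdOrthonormalBasis ℝ K).reindex (finCongr hK)
  refine ⟨fun i => b.repr ⟨y i, Submodule.subset_span ⟨i, rfl⟩⟩, fun i j => ?_⟩
  rw [LinearIsometryEquiv.inner_map_map, hy]
  rfl

theorem P_subset_sphericalGram (hn : 2 ≤ n) : P m m n ⊆ sphericalGram m n := by
  rintro A ⟨hA, hr, s, c, hs, hc⟩
  have hsu : s = Finset.univ := (Finset.card_eq_iff_eq_univ s).1
    (le_antisymm (by simpa using s.card_le_univ) (by simpa using hs))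
  subst hsu
  obtain ⟨x, hx⟩ := exists_gram_of_posSemidef hA hr
  have hxc : ∀ i, ‖x i‖ ^ 2 = c := fun i => by
    rw [← real_inner_self_eq_norm_sq, ← hx, hc i (Finset.mem_univ i)]
  have hc0 : 0 < c := by
    by_contra hcon
    have hx0 : ∀ i, x i = 0 := fun i => by
      have h1 := hxc i
      have h2 : ‖x i‖ ^ 2 = 0 := le_antisymm (by linarith) (sq_nonneg _)
      simpa using h2
    have : A = 0 := by
      ext i j
      simp [hx, hx0]
    rw [this, Matrix.rank_zero] at hr
    omega
  have hsc : √c ≠ 0 := (Real.sqrt_pos.2 hc0).ne'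
  refine ⟨c, fun i => (√c)⁻¹ • x i, hc0, fun i => ?_, fun i j => ?_⟩
  · rw [norm_smul, norm_inv, Real.norm_of_nonneg (Real.sqrt_nonneg c), ← hxc i,
      Real.sqrt_sq (norm_nonneg _), inv_mul_cancel₀]
    rw [← Real.sqrt_sq (norm_nonneg (x i)), hxc i]
    exact hsc
  · rw [hx, inner_smul_left, inner_smul_right, conj_trivial, ← mul_assoc, ← mul_assoc, mul_assoc c,
      ← mul_inv, Real.mul_self_sqrt hc0.le, mul_inv_cancel₀ hc0.ne', one_mul]

theorem le_rank_of_det_ne_zero {A : Matrix (Fin m) (Fin m) ℝ} {S : Finset (Fin m)}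
    (h : (A.submatrix (Subtype.val : S → Fin m) Subtype.val).det ≠ 0) : S.card ≤ A.rank := by
  have h1 := Matrix.rank_of_isUnit _ ((Matrix.isUnit_iff_isUnit_det _).2 (isUnit_iff_ne_zero.2 h))
  rw [Fintype.card_coe] at h1
  rw [← h1]
  exact A.rank_submatrix_le _ _

theorem mem_P_of_mem_sphericalGram {A : Matrix (Fin m) (Fin m) ℝ} (hA : A ∈ sphericalGram m n)
    (hr : n ≤ A.rank) : A ∈ P m m n := by
  obtain ⟨c, x, hc, hx, h⟩ := hA
  have hg : A = c • Matrix.gram ℝ x := by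
    ext i j
    simp [h]
  refine ⟨hg ▸ (Matrix.posSemidef_gram ℝ x).smul hc.le, le_antisymm ?_ hr, Finset.univ, c,
    by simp, fun i _ => by rw [h, real_inner_self_eq_norm_sq, hx]; ring⟩
  rw [hg, Matrix.gram_eq_conjTranspose_mul (EuclideanSpace.basisFun (Fin n) ℝ), ← Matrix.mul_smul]
  exact (Matrix.rank_mul_le_left _ _).trans (Matrix.rank_le_width _)

end SphericalGram

end GramRearrangement

/-! ### Test matrices from colorings, and rearranged minors -/

namespace GramRearrangement

section Entries

variable {m n : ℕ}

/-- The entry of a matrix at an unordered pair of indices, meaningful for symmetric matrices. -/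
noncomputable def entry (A : Matrix (Fin m) (Fin m) ℝ) (e : Sym2 (Fin m)) : ℝ :=
  A (Quot.out e).1 (Quot.out e).2

theorem entry_mk {A : Matrix (Fin m) (Fin m) ℝ} (hA : A.IsSymm) (i j : Fin m) :
    entry A s(i, j) = A i j := by
  have h : s((Quot.out s(i, j)).1, (Quot.out s(i, j)).2) = s(i, j) := Quot.out_eq s(i, j)
  rw [Sym2.eq_iff] at h
  unfold entry
  rcases h with ⟨h1, h2⟩ | ⟨h1, h2⟩
  · rw [h1, h2]
  · rw [h1, h2, hA.apply]

/-- The Gram matrix of standard basis vectors selected by a coloring. -/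
def colorGram (κ : Fin m → Fin n) : Matrix (Fin m) (Fin m) ℝ :=
  Matrix.of fun i j => if κ i = κ j then 1 else 0

theorem colorGram_mem (κ : Fin m → Fin n) : colorGram κ ∈ sphericalGram m n :=
  ⟨1, fun i => EuclideanSpace.single (κ i) 1, one_pos, fun i => by simp, fun i j => by
    simp [colorGram, EuclideanSpace.inner_single_left]⟩

theorem colorGram_isSymm (κ : Fin m → Fin n) : (colorGram κ).IsSymm := by
  ext i j
  simp [colorGram, eq_comm]

theorem entry_colorGram (κ : Fin m → Fin n) (e : Sym2 (Fin m)) :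
    entry (colorGram κ) e = if (e.map κ).IsDiag then 1 else 0 := by
  induction e using Sym2.ind with
  | _ i j =>
    rw [entry_mk (colorGram_isSymm κ)]
    simp [colorGram]

/-- Coloring one vertex `x` against all others splits exactly the non-diagonal pairs containing `x`,
so it suffices to find an `x` that splits one of `e`, `e'` only. -/
theorem exists_coloring_separating (hn : 2 ≤ n) {e e' : Sym2 (Fin m)} (he : ¬ e.IsDiag)
    (hne : e ≠ e') :
    ∃ κ : Fin m → Fin n, entry (colorGram κ) e ≠ entry (colorGram κ) e' := by
  have h01 : (⟨0, by omega⟩ : Fin n) ≠ ⟨1, by omega⟩ := by simp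
  let κ : Fin m → Fin m → Fin n := fun a i => if i = a then ⟨0, by omega⟩ else ⟨1, by omega⟩
  have hκ : ∀ a i j, κ a i = κ a j ↔ (i = a ↔ j = a) := fun a i j => by
    simp only [κ]
    split_ifs <;> simp_all
  simp only [entry_colorGram]
  induction e using Sym2.ind with
  | _ a b =>
  induction e' using Sym2.ind with
  | _ c d =>
  rw [Sym2.mk_isDiag_iff] at he
  simp only [ne_eq, Sym2.eq_iff] at hne
  simp only [Sym2.map_mk, Sym2.mk_isDiag_iff]
  have key : ∃ x, ¬ ((κ x a = κ x b) ↔ (κ x c = κ x d)) := by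
    by_cases hcd : c = d
    · exact ⟨a, by rw [hκ, hκ]; grind⟩
    · by_cases hc : c = a ∨ c = b
      · exact ⟨d, by rw [hκ, hκ]; grind⟩
      · exact ⟨c, by rw [hκ, hκ]; grind⟩
  obtain ⟨x, hx⟩ := key
  refine ⟨κ x, ?_⟩
  split_ifs <;> simp_all

/-- For a kernel vector `v`, the leaf rows give `v i = -v p`, the rows off the star give `0`, and
row `p` leaves `(1 - |L|) v p = 0`. One leaf is the only singular case. -/
theorem det_star_ne_zero {ι : Type*} [Fintype ι] [DecidableEq ι] {M : Matrix ι ι ℝ} {p : ι}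
    {L : Finset ι} (hp : p ∉ L) (hL : L.card ≠ 1)
    (hM : ∀ i j, M i j = if i = j ∨ (i = p ∧ j ∈ L ∨ j = p ∧ i ∈ L) then 1 else 0) :
    M.det ≠ 0 := by
  rw [Ne, ← Matrix.exists_mulVec_eq_zero_iff]
  rintro ⟨v, hv, h⟩
  apply hv
  have hrow : ∀ i, ∑ j, M i j * v j = 0 := fun i => congrFun h i
  have hleaf : ∀ i ∈ L, v i = - v p := fun i hi => by
    have hip : i ≠ p := fun hc => hp (hc ▸ hi)
    have h1 := hrow i
    rw [← Finset.sum_subset (Finset.subset_univ {i, p}), Finset.sum_pair hip, hM, hM] at h1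
    · simp [hi] at h1
      linarith
    · intro j _ hj
      simp only [Finset.mem_insert, Finset.mem_singleton, not_or] at hj
      rw [hM, if_neg, zero_mul]
      rintro (hc | ⟨hc, -⟩ | ⟨hc, -⟩)
      exacts [hj.1 hc.symm, hip hc, hj.2 hc]
  have hout : ∀ i, i ≠ p → i ∉ L → v i = 0 := fun i hip hi => by
    have h1 := hrow i
    rw [Finset.sum_eq_single i] at h1
    · rw [hM, if_pos (Or.inl rfl), one_mul] at h1
      exact h1
    · intro j _ hj
      rw [hM, if_neg, zero_mul]
      rintro (hc | ⟨hc, -⟩ | ⟨-, hc⟩)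
      exacts [hj hc.symm, hip hc, hi hc]
    · simp
  have hvp : v p = 0 := by
    have h1 := hrow p
    rw [← Finset.sum_subset (Finset.subset_univ (insert p L)), Finset.sum_insert hp] at h1
    · rw [hM, if_pos (Or.inl rfl), Finset.sum_congr rfl (g := fun _ => - v p) (fun j hj => by
        rw [hM, if_pos (Or.inr (Or.inl ⟨rfl, hj⟩)), hleaf j hj, one_mul])] at h1
      rw [Finset.sum_const, nsmul_eq_mul] at h1
      have h2 : (1 - (L.card : ℝ)) * v p = 0 := by linarith
      rcases mul_eq_zero.1 h2 with h3 | h3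
      · exact absurd (by exact_mod_cast (sub_eq_zero.1 h3).symm) hL
      · exact h3
    · intro j _ hj
      rw [Finset.mem_insert, not_or] at hj
      rw [hM, if_neg, zero_mul]
      rintro (hc | ⟨-, hc⟩ | ⟨hc, -⟩)
      exacts [hj.1 hc.symm, hj.2 hc, hj.1 hc]
  funext i
  by_cases hip : i = p
  · rw [hip, hvp]; rfl
  · by_cases hi : i ∈ L
    · rw [hleaf i hi, hvp, neg_zero]; rfl
    · exact hout i hip hi

/-- The principal minor on `S` of the matrix whose entries are rearranged by `π`. -/
noncomputable def rearrangedMinor (π : Equiv.Perm (Sym2 (Fin m))) (S : Finset (Fin m)) :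
    MvPolynomial (Fin m × Fin m) ℝ :=
  (Matrix.of fun i j : S => MvPolynomial.X (R := ℝ) (Quot.out (π s(i.1, j.1)))).det

theorem eval_rearrangedMinor (π : Equiv.Perm (Sym2 (Fin m))) (S : Finset (Fin m))
    (A : Matrix (Fin m) (Fin m) ℝ) :
    MvPolynomial.eval (fun p => A p.1 p.2) (rearrangedMinor π S) =
      (Matrix.of fun i j : S => entry A (π s(i.1, j.1))).det := by
  rw [rearrangedMinor, RingHom.map_det]
  congr 1
  ext i j
  simp [entry]

theorem eval_rearrangedMinor_colorGram_ne_zero {π : Equiv.Perm (Sym2 (Fin m))}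
    (hπ : ∀ e, (π e).IsDiag ↔ e.IsDiag) {S : Finset (Fin m)} {κ : Fin m → Fin n} {p : Fin m}
    (hp : p ∈ S) {L : Finset (Fin m)} (hLS : L ⊆ S.erase p) (hL : L.card ≠ 1)
    (h : ∀ i ∈ S, ∀ j ∈ S, i ≠ j →
      (((π s(i, j)).map κ).IsDiag ↔ (i = p ∧ j ∈ L ∨ j = p ∧ i ∈ L))) :
    MvPolynomial.eval (fun p => colorGram κ p.1 p.2) (rearrangedMinor π S) ≠ 0 := by
  rw [eval_rearrangedMinor]
  have hmap : ∀ e : Sym2 (Fin m), e.IsDiag → (e.map κ).IsDiag := fun e => by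
    induction e using Sym2.ind with
    | _ a b =>
      simp only [Sym2.map_mk, Sym2.mk_isDiag_iff]
      exact fun h => congrArg κ h
  refine det_star_ne_zero (p := ⟨p, hp⟩) (L := L.subtype (· ∈ S)) ?_ ?_ fun i j => ?_
  · simpa using fun hc => (Finset.mem_erase.1 (hLS hc)).1 rfl
  · rwa [Finset.card_subtype, Finset.filter_true_of_mem fun x hx =>
      (Finset.mem_erase.1 (hLS hx)).2]
  · rw [Matrix.of_apply, entry_colorGram]
    congr 1
    by_cases hij : i = j
    · subst hij
      simpa using hmap _ ((hπ _).2 (by simp))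
    · have := h i i.2 j j.2 (fun hc => hij (Subtype.ext hc))
      simp [this, hij, Subtype.ext_iff]

/-- If `B` is a symmetric rearrangement of a matrix `A` whose off-diagonal entries are pairwise
distinct and distinct from the diagonal ones, its entries are those of `A` up to a permutation of
the unordered pairs of indices. -/
theorem IsSymmRearrangement.exists_perm {A B : Matrix (Fin m) (Fin m) ℝ}
    (h : IsSymmRearrangement A B)
    (hA : ∀ e e' : Sym2 (Fin m), ¬ e.IsDiag → e ≠ e' → entry A e ≠ entry A e') :
    ∃ π : Equiv.Perm (Sym2 (Fin m)), (∀ e, (π e).IsDiag ↔ e.IsDiag) ∧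
      ∀ e, entry B e = entry A (π e) := by
  classical
  obtain ⟨hAs, hBs, hd, ht⟩ := h
  have hdiag : ∀ e : Sym2 (Fin m), e.IsDiag → entry B e = entry A e := fun e => by
    induction e using Sym2.ind with
    | _ i j =>
      intro hij
      rw [Sym2.mk_isDiag_iff] at hij
      rw [entry_mk hAs, entry_mk hBs, hij, hd]
  -- An off-diagonal entry of `A` cannot occur on the diagonal of `B`, which is that of `A`.
  have hex : ∀ e : {e : Sym2 (Fin m) // ¬ e.IsDiag}, ∃ e' : {e : Sym2 (Fin m) // ¬ e.IsDiag},
      entry B e'.1 = entry A e.1 := by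
    rintro ⟨e, he⟩
    have he2 := he
    induction e using Sym2.ind with
    | _ i j =>
      obtain ⟨k, l, hkl⟩ : (A i i, A j j, A i j) ∈ triples B := ht ▸ ⟨i, j, rfl⟩
      simp only [Prod.mk.injEq] at hkl
      have hB : entry B s(k, l) = entry A s(i, j) := by
        rw [entry_mk hAs, entry_mk hBs, hkl.2.2]
      refine ⟨⟨s(k, l), fun hc => ?_⟩, hB⟩
      rw [hdiag _ hc] at hB
      exact hA _ s(k, l) he (fun heq => he (heq ▸ hc)) hB.symm
  choose ψ hψ using hex
  have hinj : Function.Injective ψ := fun e e' hee => by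
    by_contra hne
    exact hA e.1 e'.1 e.2 (fun hc => hne (Subtype.ext hc)) (by rw [← hψ, ← hψ, hee])
  let φ := (Equiv.ofBijective ψ (Finite.injective_iff_bijective.1 hinj)).symm
  have hφ : ∀ e, ψ (φ e) = e := fun e => Equiv.ofBijective_apply_symm_apply ψ _ e
  refine ⟨Equiv.Perm.ofSubtype φ, fun e => ?_, fun e => ?_⟩
  · by_cases he : e.IsDiag
    · rw [Equiv.Perm.ofSubtype_apply_of_not_mem φ (not_not.2 he)]
    · rw [Equiv.Perm.ofSubtype_apply_of_mem φ he]
      exact iff_of_false (φ ⟨e, he⟩).2 he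
  · by_cases he : e.IsDiag
    · rw [Equiv.Perm.ofSubtype_apply_of_not_mem φ (not_not.2 he), hdiag e he]
    · rw [Equiv.Perm.ofSubtype_apply_of_mem φ he, ← hψ, hφ]

theorem isEquivalent_of_perm {A B : Matrix (Fin m) (Fin m) ℝ} (hA : A.PosSemidef)
    (hr : A.rank = n) (σ : Equiv.Perm (Fin m)) (h : ∀ i j, B i j = A (σ i) (σ j)) :
    IsEquivalent n A B := by
  obtain ⟨x, hx⟩ := exists_gram_of_posSemidef hA hr
  have key : ∀ i j, A i j = ∑ k, x i k * x j k := fun i j => by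
    rw [hx, PiLp.inner_apply]
    exact Finset.sum_congr rfl fun k _ => by simp [mul_comm]
  refine ⟨Matrix.of fun k i => x i k, σ, ?_, ?_⟩
  · ext i j
    simp [key, Matrix.mul_apply]
  · ext i j
    simp [h, key, Matrix.mul_apply]

end Entries

end GramRearrangement

/-! ### The generic set and the main theorem -/

open GramRearrangement

theorem proposition3p3 (m n : ℕ) (hn : 2 ≤ n) (hmn : n < m) :
    ∃ U : Set (Matrix (Fin m) (Fin m) ℝ),
      GramRearrangement.IsZariskiOpenIn (GramRearrangement.P m m n) U ∧
      U.Nonempty ∧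
      GramRearrangement.IsZariskiDenseIn (GramRearrangement.P m m n) U ∧
      ∀ A ∈ U, ∀ B : Matrix (Fin m) (Fin m) ℝ,
        GramRearrangement.IsSymmRearrangement A B →
        ¬ GramRearrangement.IsEquivalent n A B →
        B ∉ GramRearrangement.P m m n := by
  classical
  let f : (Sym2 (Fin m) × Sym2 (Fin m)) ⊕ (Equiv.Perm (Sym2 (Fin m)) × Finset (Fin m)) →
      MvPolynomial (Fin m × Fin m) ℝ := Sum.elim
    (fun e => MvPolynomial.X (Quot.out e.1) - MvPolynomial.X (Quot.out e.2))
    (fun q => rearrangedMinor q.1 q.2)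
  -- Only polynomials not identically zero on `sphericalGram m n` are kept, so by irreducibility
  -- their product `F` is not identically zero there either.
  let s := Finset.univ.filter fun a => ∃ A ∈ sphericalGram m n,
    MvPolynomial.eval (fun p => A p.1 p.2) (f a) ≠ 0
  let F : MvPolynomial (Fin m × Fin m) ℝ := ∏ a ∈ s, f a
  have hF : ∀ A : Matrix (Fin m) (Fin m) ℝ, MvPolynomial.eval (fun p => A p.1 p.2) F ≠ 0 →
      ∀ a, ∀ C ∈ sphericalGram m n, MvPolynomial.eval (fun p => C p.1 p.2) (f a) ≠ 0 →
        MvPolynomial.eval (fun p => A p.1 p.2) (f a) ≠ 0 := by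
    intro A hA a C hC hfC
    rw [map_prod, Finset.prod_ne_zero_iff] at hA
    exact hA a (Finset.mem_filter.2 ⟨Finset.mem_univ _, C, hC, hfC⟩)
  have hrank : ∀ A ∈ sphericalGram m n, MvPolynomial.eval (fun p => A p.1 p.2) F ≠ 0 →
      A ∈ P m m n := by
    intro A hA hFA
    -- The first `n` indices get distinct colors, so the leading `n × n` minor equals 1 here and is
    -- a factor of `F`. Hence `F ≠ 0` forces rank `n`.
    let κ : Fin m → Fin n := fun i => if h : i.1 < n then ⟨i, h⟩ else ⟨0, by omega⟩
    let S : Finset (Fin m) := Finset.univ.image (Fin.castLE hmn.le)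
    have hS : S.card = n := by
      rw [Finset.card_image_of_injective _ (Fin.castLE_injective hmn.le)]
      simp
    have hSlt : ∀ i ∈ S, i.1 < n := by
      intro i hi
      obtain ⟨k, -, rfl⟩ := Finset.mem_image.1 hi
      exact k.2
    have h0 : (⟨0, by omega⟩ : Fin m) ∈ S :=
      Finset.mem_image.2 ⟨⟨0, by omega⟩, Finset.mem_univ _, rfl⟩
    have h1 := hF A hFA (Sum.inr (1, S)) _ (colorGram_mem κ)
      (eval_rearrangedMinor_colorGram_ne_zero (fun e => Iff.rfl) h0 (L := ∅) (by simp) (by simp)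
        fun i hi j hj hij => by
          simpa [κ, hSlt i hi, hSlt j hj, Fin.ext_iff] using hij)
    simp only [f, Sum.elim_inr, eval_rearrangedMinor, Equiv.Perm.one_apply] at h1
    have hAs : A.IsSymm := by
      obtain ⟨c, x, -, -, h⟩ := hA
      ext i j
      rw [Matrix.transpose_apply, h, h, real_inner_comm]
    simp only [entry_mk hAs] at h1
    exact mem_P_of_mem_sphericalGram hA (hS ▸ le_rank_of_det_ne_zero h1)
  obtain ⟨A₀, hA₀, hFA₀⟩ : ∃ A ∈ sphericalGram m n,
      MvPolynomial.eval (fun p => A p.1 p.2) F ≠ 0 :=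
    sphericalGram_prod_ne_zero hn s f ⟨_, colorGram_mem fun _ => ⟨0, by omega⟩⟩
      fun a ha => (Finset.mem_filter.1 ha).2
  refine ⟨{A | A ∈ P m m n ∧ MvPolynomial.eval (fun p => A p.1 p.2) F ≠ 0}, ⟨{F}, by simp⟩,
    ⟨A₀, hrank A₀ hA₀ hFA₀, hFA₀⟩, ⟨fun A hA => hA.1, ?_⟩, ?_⟩
  · rintro W ⟨T, rfl⟩ ⟨A, hA, hT⟩
    push Not at hT
    obtain ⟨g, hgT, hgA⟩ := hT
    obtain ⟨C, hC, hgF⟩ := sphericalGram_irreducible hn (P_subset_sphericalGram hn hA) hA₀ hgA hFA₀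
    rw [map_mul] at hgF
    have hCP := hrank C hC (right_ne_zero_of_mul hgF)
    exact ⟨C, ⟨hCP, fun h => left_ne_zero_of_mul hgF (h g hgT)⟩, hCP, right_ne_zero_of_mul hgF⟩
  · rintro A ⟨hAP, hFA⟩ B hAB hne hBP
    have hdist : ∀ e e' : Sym2 (Fin m), ¬ e.IsDiag → e ≠ e' → entry A e ≠ entry A e' := by
      intro e e' he hee
      obtain ⟨κ, hκ⟩ := exists_coloring_separating hn he hee
      have h1 := hF A hFA (Sum.inl (e, e')) _ (colorGram_mem κ) (by
        simpa [f, entry, sub_eq_zero] using hκ)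
      simpa [f, entry, sub_eq_zero] using h1
    obtain ⟨π, hπ, hBπ⟩ := hAB.exists_perm hdist
    have hdeg : IsDegeneratePerm n π := by
      intro S hS κ p hp L hLS hL h
      have h1 := hF A hFA (Sum.inr (π, S)) _ (colorGram_mem κ)
        (eval_rearrangedMinor_colorGram_ne_zero hπ hp hLS hL h)
      simp only [f, Sum.elim_inr, eval_rearrangedMinor, ← hBπ, entry_mk hAB.2.1] at h1
      have h2 := le_rank_of_det_ne_zero (A := B) h1
      rw [hS, hBP.2.1] at h2
      omega
    obtain ⟨σ, hσ⟩ := hdeg.exists_perm hn (by simpa using hmn) hπ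
    refine hne (isEquivalent_of_perm hAP.1 hAP.2.1 σ fun i j => ?_)
    -- `σ` controls only the off-diagonal pairs; on the diagonal the constancy of the entries is
    -- what matches `B` with `A`.
    by_cases hij : i = j
    · subst hij
      obtain ⟨c, x, -, hx, h⟩ := P_subset_sphericalGram hn hAP
      rw [hAB.2.2.1, h, h, real_inner_self_eq_norm_sq, real_inner_self_eq_norm_sq, hx, hx]
    · rw [← entry_mk hAB.2.1, hBπ, hσ i j hij, entry_mk hAB.1]
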